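/- For integers $d, a, n \geq 1$, let $q_d^{(a)}(n)$ denote the number of partitions of $n$ into parts of size at least $a$ in which any two parts (occurring at different positions) differ by at least $d$. For integers $d, b, n \geq 1$ with $b \leq d+2$, let $Q_d^{(b,-,-)}(n)$ denote the number of partitions of $n$ into parts congruent to $\pm b$ modulo $d+3$, where the parts $b$ and $d+3-b$ are not allowed. If $d$ is an integer with $d = 15$ or $d \geq 31$, then for all integers $n \geq 1$, $$q_d^{(1)}(n) \geq Q_{d-3}^{(1,-,-)}(n).$$ Here $Q_{d-3}^{(1,-,-)}(n)$ counts the partitions of $n$ into parts congruent to $\pm 1$ modulo $d$, other than the parts $1$ and $d-1$. -/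

import Mathlib

/-- `gapPartitionCount d a n` is `q_d^{(a)}(n)`: the number of partitions of `n` into parts of size
at least `a` such that parts at different positions differ by at least `d`. The sorted list of parts
is non-increasing, so the gap condition says that each part exceeds every later one by at least `d`
(in particular, for `d ≥ 1`, no part is repeated). -/
def gapPartitionCount (d a n : ℕ) : ℕ :=
  (Finset.univ.filter fun π : n.Partition =>
    (∀ x ∈ π.parts, a ≤ x) ∧
      (π.parts.sort (· ≥ ·)).Pairwise fun x y => y + d ≤ x).card

/-- `residuePartitionCount d b n` is `Q_d^{(b,-,-)}(n)`, for `1 ≤ b ≤ d + 2`: the number of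
partitions of `n` into parts congruent to `± b` modulo `d + 3`, excluding the parts `b` and
`d + 3 - b`. -/
def residuePartitionCount (d b n : ℕ) : ℕ :=
  (Nat.Partition.restricted n fun x =>
    ((x : ℤ) ≡ b [ZMOD (d + 3)] ∨ (x : ℤ) ≡ -b [ZMOD (d + 3)]) ∧
      x ≠ b ∧ (x : ℤ) ≠ d + 3 - b).card

/-! Both counts are compared with explicit quantities depending only on `m = ⌊2n/(2d-1)⌋`.

Upper bound for `Q`: a part `jd ± 1` gets weight `j`. Since `1` and `d - 1` are excluded, `(2d-1)j ≤
2x` for every allowed part `x`, so a partition of `n` has total weight at most `m`. The available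
weights are `1, 2, 2, 3, 3, …`, whence `residuePartitionCount_lt`.

Lower bound for `q`: only partitions with exactly `k` parts are counted. Removing the staircase `1,
1 + d, …` leaves partitions of some `N` into at most `k` parts, and there are at least
`(N+1)⋯(N+k-1) / (k! (k-1)!)` of them (`ascFactorial_le_mul_ncard_gapLists`).

For `d ≥ 15` the value of `N` is smallest, in terms of `m`, at `d = 15`, which leaves an inequality
in `m` alone. With `k` about `√m`, the weight count grows like `exp((2π/√3)√m)`, about `37.6^k`, and
the lower bound like `(7e²)^k`, about `51.7^k`, up to factors of lower order. Large `k` is settled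
by estimates, medium `k` by numerical instances of the same upper bound, small `k` by exact values.
-/

/-! ### Lower bound for partitions with gaps -/

/-- Lists of `k` positive integers with sum `n` in which every entry exceeds each later one by at
least `d`. -/
def gapLists (d k n : ℕ) : Set (List ℕ) :=
  {l | l.Pairwise (fun x y => y + d ≤ x) ∧ (∀ x ∈ l, 1 ≤ x) ∧ l.length = k ∧ l.sum = n}

theorem gapLists_subset_image (d k n : ℕ) :
    gapLists d k n ⊆ ((Finset.univ.filter fun π : n.Partition =>
      (∀ x ∈ π.parts, 1 ≤ x) ∧ (π.parts.sort (· ≥ ·)).Pairwise fun x y => y + d ≤ x).image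
        fun π => π.parts.sort (· ≥ ·) : Finset (List ℕ)) := by
  rintro l ⟨hl, hpos, -, hsum⟩
  have hsort : (l : Multiset ℕ).sort (· ≥ ·) = l := by
    rw [Multiset.coe_sort]
    apply List.mergeSort_of_pairwise
    exact hl.imp fun {x y} h => by simpa using (by omega : y ≤ x)
  simp only [Finset.coe_image, Set.mem_image, Finset.coe_filter, Finset.mem_univ, true_and,
    Set.mem_ofPred_eq]
  refine ⟨⟨l, fun {x} hx => hpos x (by simpa using hx), by simpa using hsum⟩, ⟨?_, ?_⟩, hsort⟩
  · intro x hx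
    exact hpos x (by simpa using hx)
  · simpa only [hsort] using hl

theorem finite_gapLists (d k n : ℕ) : (gapLists d k n).Finite :=
  (Finset.finite_toSet _).subset (gapLists_subset_image d k n)

theorem ncard_gapLists_le (d k n : ℕ) : (gapLists d k n).ncard ≤ gapPartitionCount d 1 n := by
  refine (Set.ncard_le_ncard (gapLists_subset_image d k n) (Finset.finite_toSet _)).trans ?_
  rw [Set.ncard_coe_finset]
  exact Finset.card_image_le

theorem list_sum_map_add (l : List ℕ) (c : ℕ) : (l.map (· + c)).sum = l.sum + l.length * c := by
  induction l with
  | nil => simp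
  | cons a l ih => simp [ih]; ring

theorem map_add_mem_gapLists {d k n : ℕ} {l : List ℕ} (hl : l ∈ gapLists d k n) (c : ℕ) :
    l.map (· + c) ∈ gapLists d k (n + k * c) := by
  obtain ⟨h1, h2, h3, h4⟩ := hl
  refine ⟨?_, ?_, by simpa using h3, by rw [list_sum_map_add, h3, h4]⟩
  · rw [List.pairwise_map]
    exact h1.imp fun {x y} h => by omega
  · intro x hx
    obtain ⟨y, hy, rfl⟩ := List.mem_map.1 hx
    have := h2 y hy
    omega

theorem map_add_append_mem_gapLists {d k n : ℕ} {l : List ℕ} (hl : l ∈ gapLists d k n) :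
    l.map (· + d) ++ [1] ∈ gapLists d (k + 1) (n + k * d + 1) := by
  obtain ⟨h1, h2, h3, h4⟩ := map_add_mem_gapLists hl d
  refine ⟨?_, ?_, by simp [h3], by simp [h4]⟩
  · rw [List.pairwise_append]
    refine ⟨h1, by simp, ?_⟩
    intro x hx y hy
    obtain ⟨z, hz, rfl⟩ := List.mem_map.1 hx
    have := hl.2.1 z hz
    simp only [List.mem_singleton] at hy
    omega
  · intro x hx
    rcases List.mem_append.1 hx with hx | hx
    · exact h2 x hx
    · simp only [List.mem_singleton] at hx
      omega

theorem injective_map_add (c : ℕ) : Function.Injective (List.map (· + c) : List ℕ → List ℕ) :=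
  List.map_injective_iff.2 (add_left_injective c)

/-- A list of `k + 1` parts is obtained by adding `1` to all parts, or by adding `d` to all parts
and appending the part `1`. -/
theorem ncard_gapLists_add_le (d k n : ℕ) :
    (gapLists d k n).ncard ≤ (gapLists d (k + 1) (n + k * d + 1)).ncard := by
  refine Set.ncard_le_ncard_of_injOn (fun l => l.map (· + d) ++ [1])
    (fun l hl => map_add_append_mem_gapLists hl) ?_ (finite_gapLists _ _ _)
  intro l _ l' _ h
  exact injective_map_add d (List.append_cancel_right h)

/-- The two constructions have disjoint images: only the first produces the part `1`. -/
theorem ncard_gapLists_add_ncard_le {d k n n' : ℕ} (h : n' + (k + 1) = n + k * d + 1) :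
    (gapLists d k n).ncard + (gapLists d (k + 1) n').ncard ≤
      (gapLists d (k + 1) (n + k * d + 1)).ncard := by
  have e1 : ((fun l : List ℕ => l.map (· + d) ++ [1]) '' gapLists d k n).ncard =
      (gapLists d k n).ncard :=
    Set.ncard_image_of_injective _ fun l l' h => injective_map_add d (List.append_cancel_right h)
  have e2 : (List.map (· + 1) '' gapLists d (k + 1) n').ncard = (gapLists d (k + 1) n').ncard :=
    Set.ncard_image_of_injective _ (injective_map_add 1)
  rw [← e1, ← e2, ← Set.ncard_union_eq _ ((finite_gapLists _ _ _).image _)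
    ((finite_gapLists _ _ _).image _)]
  · refine Set.ncard_le_ncard ?_ (finite_gapLists _ _ _)
    rintro _ (⟨l, hl, rfl⟩ | ⟨l, hl, rfl⟩)
    · exact map_add_append_mem_gapLists hl
    · have := map_add_mem_gapLists hl 1
      rwa [mul_one, h] at this
  · rw [Set.disjoint_left]
    rintro _ ⟨l, hl, rfl⟩ ⟨l', hl', h'⟩
    have : 1 ∈ l'.map (· + 1) := by
      rw [h']; simp
    obtain ⟨y, hy, hy'⟩ := List.mem_map.1 this
    have := hl'.2.1 y hy
    omega

theorem ascFactorial_succ_eq_add (x r : ℕ) :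
    (x + 2).ascFactorial (r + 1) = (x + 1).ascFactorial (r + 1) + (r + 1) * (x + 2).ascFactorial r := by
  have h1 : (x + 1).ascFactorial (r + 1) = (x + 1) * (x + 2).ascFactorial r := by
    rw [Nat.ascFactorial_succ, Nat.succ_ascFactorial]
  rw [h1, Nat.ascFactorial_succ]
  ring

theorem ascFactorial_mono {x y : ℕ} (h : x ≤ y) (r : ℕ) : x.ascFactorial r ≤ y.ascFactorial r := by
  induction r with
  | zero => simp
  | succ r ih =>
    rw [Nat.ascFactorial_succ, Nat.ascFactorial_succ]
    exact Nat.mul_le_mul (by omega) ih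

/-- A discrete mean value inequality: each unit step changes the rising factorial by `r + 1` times
one of lower degree, largest at the right end. -/
theorem ascFactorial_add_le (x r j : ℕ) :
    (x + j + 1).ascFactorial (r + 1) ≤
      (x + 1).ascFactorial (r + 1) + j * ((r + 1) * (x + j + 1).ascFactorial r) := by
  induction j with
  | zero => simp
  | succ j ih =>
    have h := ascFactorial_succ_eq_add (x + j) r
    have hm := ascFactorial_mono (show x + j + 1 ≤ x + j + 2 by omega) r
    have : x + (j + 1) + 1 = x + j + 2 := by ring
    rw [this, h]
    have h2 : j * ((r + 1) * (x + j + 1).ascFactorial r) ≤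
        j * ((r + 1) * (x + j + 2).ascFactorial r) := by gcongr
    linarith

/-- Lowering `N` by `k + 2` in the recurrence for `k + 2` parts costs, by the mean value inequality,
exactly the factor `(k+2)(k+1)` by which the factorials grow. -/
theorem ascFactorial_le_mul_ncard_gapLists (d k N : ℕ) :
    (N + 1).ascFactorial k ≤ (k + 1).factorial * k.factorial *
      (gapLists d (k + 1) (N + (k + 1) + d * (k * (k + 1) / 2))).ncard := by
  induction k generalizing N with
  | zero =>
    have : [N + 1] ∈ gapLists d 1 (N + 1) := ⟨by simp, by simp, by simp, by simp⟩
    simpa [Nat.one_le_iff_ne_zero, Nat.pos_iff_ne_zero] using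
      (Set.ncard_pos (finite_gapLists _ _ _)).2 ⟨_, this⟩
  | succ k ih =>
    have htri : (k + 1) * (k + 1 + 1) / 2 = k * (k + 1) / 2 + (k + 1) := by
      have : (k + 1) * (k + 1 + 1) = k * (k + 1) + (k + 1) * 2 := by ring
      rw [this, Nat.add_mul_div_right _ _ (by norm_num)]
    induction N using Nat.strong_induction_on with
    | _ N ihN =>
      have hfac : (k + 1 + 1).factorial * (k + 1).factorial =
          ((k + 2) * (k + 1)) * ((k + 1).factorial * k.factorial) := by
        rw [Nat.factorial_succ (k + 1), Nat.factorial_succ k]; ring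
      have e : N + (k + 1 + 1) + d * ((k + 1) * (k + 1 + 1) / 2) =
          (N + (k + 1) + d * (k * (k + 1) / 2)) + (k + 1) * d + 1 := by
        rw [htri]; ring
      by_cases hN : k + 2 ≤ N
      · obtain ⟨M, rfl⟩ := Nat.exists_eq_add_of_le hN
        have h1 := ih (k + 2 + M)
        have h2 := ihN M (by omega)
        have h3 := ncard_gapLists_add_ncard_le (d := d) (k := k + 1)
          (n := k + 2 + M + (k + 1) + d * (k * (k + 1) / 2))
          (n' := M + (k + 1 + 1) + d * ((k + 1) * (k + 1 + 1) / 2)) (by rw [htri]; ring)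
        rw [e]
        have h4 := ascFactorial_add_le M k (k + 2)
        have e4 : M + (k + 2) + 1 = k + 2 + M + 1 := by ring
        rw [e4] at h4
        calc _ ≤ _ := h4
          _ ≤ (k + 1 + 1).factorial * (k + 1).factorial *
                (gapLists d (k + 1 + 1) (M + (k + 1 + 1) + d * ((k + 1) * (k + 1 + 1) / 2))).ncard +
              (k + 2) * ((k + 1) * ((k + 1).factorial * k.factorial *
                (gapLists d (k + 1) (k + 2 + M + (k + 1) + d * (k * (k + 1) / 2))).ncard)) := by
            gcongr
          _ = (k + 1 + 1).factorial * (k + 1).factorial *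
              ((gapLists d (k + 1) (k + 2 + M + (k + 1) + d * (k * (k + 1) / 2))).ncard +
              (gapLists d (k + 1 + 1)
                (M + (k + 1 + 1) + d * ((k + 1) * (k + 1 + 1) / 2))).ncard) := by
            rw [hfac]; ring
          _ ≤ _ := Nat.mul_le_mul_left _ h3
      -- Here `N ≤ k + 1`, so the new factor `N + 1 + k` is at most `(k+2)(k+1)` and one term of the
      -- recurrence suffices.
      · have h1 := ih N
        have h3 := ncard_gapLists_add_le d (k + 1) (N + (k + 1) + d * (k * (k + 1) / 2))
        rw [e, hfac, Nat.ascFactorial_succ]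
        calc _ ≤ ((k + 2) * (k + 1)) * ((k + 1).factorial * k.factorial *
                (gapLists d (k + 1) (N + (k + 1) + d * (k * (k + 1) / 2))).ncard) := by
              refine Nat.mul_le_mul ?_ h1
              nlinarith
          _ ≤ _ := by
              rw [← mul_assoc]
              exact Nat.mul_le_mul_left _ h3

/-! ### Upper bound for residue partitions by a weight count -/

/-- The number of ways to choose multiplicities for the entries of a list of weights such that the
total weight is at most `m`. -/
def weightCount : List ℕ → ℕ → ℕ
  | [], _ => 1
  | w :: L, m => weightCount L m + if _h : 0 < w ∧ w ≤ m then weightCount (w :: L) (m - w) else 0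
termination_by L m => (L.length, m)

theorem weightCount_nil (m : ℕ) : weightCount [] m = 1 := by
  rw [weightCount]

theorem weightCount_cons {w : ℕ} (hw : 0 < w) (L : List ℕ) (m : ℕ) :
    weightCount (w :: L) m =
      weightCount L m + if w ≤ m then weightCount (w :: L) (m - w) else 0 := by
  rw [weightCount]
  simp [hw]

/-- Ties the recursion to multisets by splitting on whether `s` is used. Distinct elements may share
a weight, so `f` need not be injective. -/
theorem exists_finset_card_le_weightCount (f : ℕ → ℕ) (S : List ℕ) (hS : ∀ s ∈ S, 0 < f s) (m : ℕ) :
    ∃ F : Finset (Multiset ℕ), F.card ≤ weightCount (S.map f) m ∧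
      ∀ M : Multiset ℕ, (∀ x ∈ M, x ∈ S) → (M.map f).sum ≤ m → M ∈ F := by
  induction S generalizing m with
  | nil =>
    refine ⟨{0}, by simp [weightCount_nil], fun M hM _ => ?_⟩
    rw [Finset.mem_singleton]
    exact Multiset.eq_zero_of_forall_notMem fun x hx => by simpa using hM x hx
  | cons s S ihS =>
    have hs : 0 < f s := hS s (by simp)
    have ihS := ihS fun t ht => hS t (by simp [ht])
    induction m using Nat.strong_induction_on with
    | _ m ihm =>
      obtain ⟨F₁, hc₁, hF₁⟩ := ihS m
      rw [List.map_cons, weightCount_cons hs]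
      by_cases hm : f s ≤ m
      · obtain ⟨F₂, hc₂, hF₂⟩ := ihm (m - f s) (by omega)
        rw [List.map_cons] at hc₂
        refine ⟨F₁ ∪ F₂.image (s ::ₘ ·), ?_, fun M hM hMm => ?_⟩
        · rw [if_pos hm]
          exact (Finset.card_union_le _ _).trans
            (Nat.add_le_add hc₁ (Finset.card_image_le.trans hc₂))
        · rw [Finset.mem_union]
          by_cases hsM : s ∈ M
          · obtain ⟨M', rfl⟩ := Multiset.exists_cons_of_mem hsM
            refine Or.inr (Finset.mem_image_of_mem _ (hF₂ M' (fun x hx => hM x (by simp [hx])) ?_))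
            rw [Multiset.map_cons, Multiset.sum_cons] at hMm
            omega
          · refine Or.inl (hF₁ M (fun x hx => ?_) hMm)
            rcases List.mem_cons.1 (hM x hx) with rfl | h
            · exact absurd hx hsM
            · exact h
      · refine ⟨F₁, by rw [if_neg hm]; exact hc₁, fun M hM hMm => hF₁ M (fun x hx => ?_) hMm⟩
        rcases List.mem_cons.1 (hM x hx) with rfl | h
        · exact absurd ((Multiset.single_le_sum (by simp) _ (Multiset.mem_map_of_mem f hx)).trans hMm)
            hm
        · exact h

/-- The list `J + 1, J + 1, …, 3, 3, 2, 2, 1`. -/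
def doubledWeights : ℕ → List ℕ
  | 0 => [1]
  | j + 1 => (j + 2) :: (j + 2) :: doubledWeights j

/-- The integers `j * d ± 1` with `1 ≤ j ≤ J + 1`, without `d - 1`. -/
def residueParts (d : ℕ) : ℕ → List ℕ
  | 0 => [d + 1]
  | j + 1 => ((j + 2) * d + 1) :: ((j + 2) * d - 1) :: residueParts d j

theorem map_residueParts {d : ℕ} (hd : 3 ≤ d) (J : ℕ) :
    (residueParts d J).map (fun s => (s + 1) / d) = doubledWeights J := by
  have h2 (j : ℕ) : (j * d + 1 + 1) / d = j := by
    rw [add_assoc, add_comm, Nat.add_mul_div_right _ _ (by omega), Nat.div_eq_of_lt (by omega),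
      zero_add]
  have h0 (j : ℕ) : ((j + 2) * d - 1 + 1) / d = j + 2 := by
    rw [Nat.sub_add_cancel (by nlinarith), Nat.mul_div_cancel _ (by omega)]
  induction J with
  | zero => simpa [residueParts, doubledWeights] using h2 1
  | succ J ih => simp [residueParts, doubledWeights, h2, h0, ih]

theorem mem_residueParts_add {d j J : ℕ} (h1 : 1 ≤ j) (hj : j ≤ J + 1) :
    j * d + 1 ∈ residueParts d J := by
  induction J with
  | zero =>
    obtain rfl : j = 1 := by omega
    simp [residueParts]
  | succ J ih =>
    rcases Nat.lt_or_ge J j with h | h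
    · rcases Nat.lt_or_ge (J + 1) j with h' | h'
      · obtain rfl : j = J + 2 := by omega
        simp [residueParts]
      · simp [residueParts, ih h']
    · simp [residueParts, ih (by omega)]

theorem mem_residueParts_sub {d j J : ℕ} (h1 : 2 ≤ j) (hj : j ≤ J + 1) :
    j * d - 1 ∈ residueParts d J := by
  induction J with
  | zero => omega
  | succ J ih =>
    rcases Nat.lt_or_ge (J + 1) j with h' | h'
    · obtain rfl : j = J + 2 := by omega
      simp [residueParts]
    · simp [residueParts, ih h']

theorem exists_eq_of_residue {d x : ℕ} (hd : 4 ≤ d) (hx : 0 < x)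
    (h : ((x : ℤ) ≡ (1 : ℕ) [ZMOD ((d - 3 : ℕ) + 3)] ∨ (x : ℤ) ≡ -(1 : ℕ) [ZMOD ((d - 3 : ℕ) + 3)]) ∧
      x ≠ 1 ∧ (x : ℤ) ≠ (d - 3 : ℕ) + 3 - (1 : ℕ)) :
    (∃ j, 1 ≤ j ∧ x = j * d + 1) ∨ ∃ j, 2 ≤ j ∧ x = j * d - 1 := by
  have hd' : ((d - 3 : ℕ) : ℤ) + 3 = d := by omega
  rw [hd'] at h
  obtain ⟨h | h, h1, h2⟩ := h
  · left
    have := (Nat.modEq_iff_dvd' (by omega)).1 (Int.natCast_modEq_iff.1 h.symm)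
    obtain ⟨j, hj⟩ := this
    refine ⟨j, ?_, by rw [mul_comm]; omega⟩
    rcases Nat.eq_zero_or_pos j with rfl | h
    · omega
    · exact h
  · right
    have h' : d ∣ x + 1 := by
      have := h.symm.dvd
      rw [sub_neg_eq_add] at this
      exact_mod_cast this
    obtain ⟨j, hj⟩ := h'
    refine ⟨j, ?_, by rw [mul_comm]; omega⟩
    rcases j with _ | _ | j
    · omega
    · omega
    · omega

theorem residuePartitionCount_lt {d n J : ℕ} (hd : 4 ≤ d) (hn : 1 ≤ n)
    (hJ : 2 * n / (2 * d - 1) ≤ J + 1) :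
    residuePartitionCount (d - 3) 1 n < weightCount (doubledWeights J) (2 * n / (2 * d - 1)) := by
  have hmap := map_residueParts (by omega : 3 ≤ d) J
  have hw (j : ℕ) : (j * d + 1 + 1) / d = j := by
    rw [add_assoc, add_comm, Nat.add_mul_div_right _ _ (by omega), Nat.div_eq_of_lt (by omega),
      zero_add]
  have hw' (j : ℕ) (hj : 2 ≤ j) : (j * d - 1 + 1) / d = j := by
    rw [Nat.sub_add_cancel (by nlinarith), Nat.mul_div_cancel _ (by omega)]
  obtain ⟨F, hF, hmem⟩ := exists_finset_card_le_weightCount (fun s => (s + 1) / d)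
    (residueParts d J) (fun s hs => by
      have : ∀ w ∈ doubledWeights J, 0 < w := by
        clear hmap hJ hs
        induction J with
        | zero => simp [doubledWeights]
        | succ J ih => simpa [doubledWeights] using ih
      exact this _ (hmap ▸ List.mem_map_of_mem hs)) (2 * n / (2 * d - 1))
  rw [hmap] at hF
  refine lt_of_lt_of_le ?_ hF
  have h0 : (0 : Multiset ℕ) ∈ F := hmem 0 (by simp) (by simp)
  -- The empty multiset is counted but is no partition of `n ≥ 1`; this gives the strict inequality.
  rw [← Finset.card_erase_add_one h0, Nat.lt_succ_iff]
  refine Finset.card_le_card_of_injOn (fun π => π.parts) ?_ fun π _ π' _ h =>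
    Nat.Partition.ext h
  intro π hπ
  have hπ := (Finset.mem_filter.1 hπ).2
  have key : ∀ x ∈ π.parts, (∃ j, 1 ≤ j ∧ x = j * d + 1) ∨ ∃ j, 2 ≤ j ∧ x = j * d - 1 :=
    fun x hx => exists_eq_of_residue hd (π.parts_pos hx) (hπ x hx)
  -- For `x = jd - 1` this says `j ≥ 2`; it would fail for the excluded part `d - 1`.
  have hwx : ∀ x ∈ π.parts, (2 * d - 1) * ((x + 1) / d) ≤ 2 * x := by
    intro x hx
    obtain ⟨e, rfl⟩ : ∃ e, d = e + 1 := ⟨d - 1, by omega⟩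
    rcases key x hx with ⟨j, hj, rfl⟩ | ⟨j, hj, rfl⟩
    · rw [hw, show 2 * (e + 1) - 1 = 2 * e + 1 by omega]
      nlinarith
    · rw [hw' j hj, show 2 * (e + 1) - 1 = 2 * e + 1 by omega]
      zify [show 1 ≤ j * (e + 1) by nlinarith]
      nlinarith
  have hsum : (π.parts.map fun s => (s + 1) / d).sum ≤ 2 * n / (2 * d - 1) := by
    rw [Nat.le_div_iff_mul_le (by omega), mul_comm, ← Multiset.sum_map_mul_left]
    calc _ ≤ (π.parts.map fun x => 2 * x).sum := Multiset.sum_map_le_sum_map _ _ hwx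
      _ = 2 * n := by rw [Multiset.sum_map_mul_left, Multiset.map_id', π.parts_sum]
  refine Finset.mem_coe.2 (Finset.mem_erase.2 ⟨?_, hmem _ (fun x hx => ?_) hsum⟩)
  · intro h
    have := π.parts_sum
    simp only [h, Multiset.sum_zero] at this
    omega
  · have hle : (x + 1) / d ≤ J + 1 :=
      (Multiset.single_le_sum (by simp) _ (Multiset.mem_map_of_mem _ hx)).trans (hsum.trans hJ)
    rcases key x hx with ⟨j, hj, rfl⟩ | ⟨j, hj, rfl⟩
    · rw [hw] at hle
      exact mem_residueParts_add hj hle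
    · rw [hw' j hj] at hle
      exact mem_residueParts_sub hj hle

/-! ### Generating function bound for the weight count -/

theorem pos_of_mem_doubledWeights {J w : ℕ} (hw : w ∈ doubledWeights J) : 0 < w := by
  induction J with
  | zero => simp_all [doubledWeights]
  | succ J ih =>
    simp only [doubledWeights, List.mem_cons] at hw
    rcases hw with rfl | rfl | hw
    · omega
    · omega
    · exact ih hw

/-- Rankin's trick: a choice of weight at most `m` contributes at least `u ^ m` to the generating
function at `u`. -/
theorem weightCount_mul_pow_le {u : ℝ} (h0 : 0 < u) (h1 : u < 1) (L : List ℕ)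
    (hL : ∀ w ∈ L, 0 < w) (m : ℕ) :
    weightCount L m * u ^ m ≤ (L.map fun w => (1 - u ^ w)⁻¹).prod := by
  induction L generalizing m with
  | nil => simpa [weightCount_nil] using pow_le_one₀ h0.le h1.le
  | cons w L ihL =>
    have hw : 0 < w := hL w (by simp)
    have ihL := ihL fun t ht => hL t (by simp [ht])
    have huw : 0 < 1 - u ^ w := sub_pos.2 (pow_lt_one₀ h0.le h1 hw.ne')
    induction m using Nat.strong_induction_on with
    | _ m ihm =>
      have hL0 := ihL m
      rw [List.map_cons, List.prod_cons] at ihm ⊢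
      set G := (L.map fun w => (1 - u ^ w)⁻¹).prod
      have hG : (1 - u ^ w)⁻¹ * G = G + u ^ w * ((1 - u ^ w)⁻¹ * G) := by
        field_simp
        ring
      have hG0 : 0 ≤ G := le_trans (by positivity) hL0
      rw [weightCount_cons hw]
      split_ifs with hwm
      · have h2 := ihm (m - w) (by omega)
        have e : u ^ m = u ^ w * u ^ (m - w) := by rw [← pow_add]; congr 1; omega
        rw [hG, Nat.cast_add, add_mul]
        refine add_le_add hL0 ?_
        rw [e, mul_left_comm]
        gcongr
      · rw [hG, add_zero]
        refine hL0.trans (le_add_of_nonneg_right ?_)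
        positivity

theorem prod_doubledWeights {u : ℝ} (h1 : u < 1) (J : ℕ) :
    ((doubledWeights J).map fun w => (1 - u ^ w)⁻¹).prod =
      (1 - u) * (∏ i ∈ Finset.range (J + 1), (1 - u ^ (i + 1))⁻¹) ^ 2 := by
  induction J with
  | zero =>
    have : 1 - u ≠ 0 := by linarith
    simp [doubledWeights]
    field_simp
  | succ J ih =>
    rw [doubledWeights, List.map_cons, List.map_cons, List.prod_cons, List.prod_cons, ih,
      Finset.prod_range_succ _ (J + 1)]
    ring

theorem pow_div_one_sub_pow_le {u : ℝ} (h0 : 0 < u) (h1 : u < 1) {n : ℕ} (hn : n ≠ 0) :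
    u ^ n / (1 - u ^ n) ≤ u / (1 - u) / n := by
  have hn' : (0 : ℝ) < n := by positivity
  have hun : 0 < 1 - u ^ n := sub_pos.2 (pow_lt_one₀ h0.le h1 hn)
  have hu : 0 < 1 - u := by linarith
  rw [div_div, div_le_div_iff₀ hun (by positivity)]
  have hgeom : 1 - u ^ n = (1 - u) * ∑ i ∈ Finset.range n, u ^ i := (mul_neg_geom_sum u n).symm
  have hle : n * u ^ (n - 1) ≤ ∑ i ∈ Finset.range n, u ^ i := by
    calc (n : ℝ) * u ^ (n - 1) = ∑ _i ∈ Finset.range n, u ^ (n - 1) := by simp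
      _ ≤ _ := Finset.sum_le_sum fun i hi =>
        pow_le_pow_of_le_one h0.le h1.le (by have := Finset.mem_range.1 hi; omega)
  have e : u ^ n = u * u ^ (n - 1) := by rw [← pow_succ']; congr 1; omega
  calc u ^ n * ((1 - u) * n) = u * (1 - u) * (n * u ^ (n - 1)) := by rw [e]; ring
    _ ≤ u * (1 - u) * ∑ i ∈ Finset.range n, u ^ i := by gcongr
    _ = u * (1 - u ^ n) := by rw [hgeom]; ring

/-- Expand the logarithms and sum over `i` first: the `n`-th term is at most `u ^ n / (n (1 - u ^
n))`, hence at most `u / (1 - u) / n ^ 2`, and `ζ(2) = π² / 6`. -/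
theorem prod_one_sub_pow_inv_le {u : ℝ} (h0 : 0 < u) (h1 : u < 1) (I : ℕ) :
    ∏ i ∈ Finset.range I, (1 - u ^ (i + 1))⁻¹ ≤ Real.exp (Real.pi ^ 2 / 6 * (u / (1 - u))) := by
  have hpos (i : ℕ) : 0 < 1 - u ^ (i + 1) := sub_pos.2 (pow_lt_one₀ h0.le h1 (by omega))
  have hu : 0 < 1 - u := by linarith
  rw [← Real.log_le_iff_le_exp (Finset.prod_pos fun i _ => inv_pos.2 (hpos i)),
    Real.log_prod fun i _ => (inv_pos.2 (hpos i)).ne']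
  have hs : HasSum (fun n : ℕ => ∑ i ∈ Finset.range I, (u ^ (i + 1)) ^ (n + 1) / ((n : ℝ) + 1))
      (∑ i ∈ Finset.range I, Real.log (1 - u ^ (i + 1))⁻¹) := by
    refine hasSum_sum fun i _ => ?_
    rw [Real.log_inv]
    refine Real.hasSum_pow_div_log_of_abs_lt_one ?_
    rw [abs_of_pos (by positivity)]
    exact pow_lt_one₀ h0.le h1 (by omega)
  have hz : HasSum (fun n : ℕ => 1 / ((n + 1 : ℕ) : ℝ) ^ 2 * (u / (1 - u)))
      (Real.pi ^ 2 / 6 * (u / (1 - u))) := by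
    have := (hasSum_nat_add_iff' 1).2 hasSum_zeta_two
    simp only [Finset.range_one, Finset.sum_singleton, Nat.cast_zero, ne_eq, OfNat.ofNat_ne_zero,
      not_false_eq_true, zero_pow, div_zero, sub_zero] at this
    exact this.mul_right _
  refine hasSum_le (fun n => ?_) hs hz
  rw [← Finset.sum_div, div_le_iff₀ (by positivity)]
  have hq : (0 : ℝ) < 1 - u ^ (n + 1) := hpos n
  calc ∑ i ∈ Finset.range I, (u ^ (i + 1)) ^ (n + 1)
      = u ^ (n + 1) * ∑ i ∈ Finset.range I, (u ^ (n + 1)) ^ i := by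
        rw [Finset.mul_sum]
        refine Finset.sum_congr rfl fun i _ => ?_
        rw [← pow_mul, ← pow_mul, ← pow_add]
        congr 1
        ring
    _ ≤ u ^ (n + 1) * (1 - u ^ (n + 1))⁻¹ := by
        gcongr
        rw [← one_div, le_div_iff₀ hq, geom_sum_mul_neg]
        linarith [pow_pos (pow_pos h0 (n + 1)) I]
    _ = u ^ (n + 1) / (1 - u ^ (n + 1)) := by rw [div_eq_mul_inv]
    _ ≤ u / (1 - u) / ((n + 1 : ℕ) : ℝ) := pow_div_one_sub_pow_le h0 h1 (by omega)
    _ = _ := by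
        push_cast
        field_simp

/-- Rankin's bound at `u = θ / (θ + 1)`, where `u / (1 - u) = θ`. -/
theorem weightCount_doubledWeights_le {θ : ℝ} (hθ : 0 < θ) (J m : ℕ) :
    weightCount (doubledWeights J) m ≤
      (1 + 1 / θ) ^ m * Real.exp (Real.pi ^ 2 / 3 * θ) / (θ + 1) := by
  have h0 : 0 < θ / (θ + 1) := by positivity
  have h1 : θ / (θ + 1) < 1 := by rw [div_lt_one (by positivity)]; linarith
  have e1 : 1 - θ / (θ + 1) = 1 / (θ + 1) := by field_simp; ring
  have e2 : θ / (θ + 1) / (1 / (θ + 1)) = θ := by field_simp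
  have e3 : θ / (θ + 1) = (1 + 1 / θ)⁻¹ := by field_simp
  have h := weightCount_mul_pow_le h0 h1 _ (fun w => pos_of_mem_doubledWeights (J := J)) m
  rw [prod_doubledWeights h1] at h
  have h2 := prod_one_sub_pow_inv_le h0 h1 (J + 1)
  rw [e1, e2] at h2
  rw [e1] at h
  have h3 : 0 ≤ ∏ i ∈ Finset.range (J + 1), (1 - (θ / (θ + 1)) ^ (i + 1))⁻¹ :=
    Finset.prod_nonneg fun i _ => inv_nonneg.2 (sub_nonneg.2 (pow_le_one₀ h0.le h1.le))
  have h4 := pow_le_pow_left₀ h3 h2 2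
  rw [← Real.exp_nat_mul] at h4
  have e4 : ((2 : ℕ) : ℝ) * (Real.pi ^ 2 / 6 * θ) = Real.pi ^ 2 / 3 * θ := by push_cast; ring
  rw [e4] at h4
  rw [e3, inv_pow, ← div_eq_mul_inv, div_le_iff₀ (by positivity)] at h
  calc _ ≤ _ := h
    _ ≤ 1 / (θ + 1) * Real.exp (Real.pi ^ 2 / 3 * θ) * (1 + 1 / θ) ^ m := by
        rw [← e3]
        gcongr
    _ = _ := by ring

theorem exp_pi_sq_div_three_le : Real.exp (Real.pi ^ 2 / 3) ≤ 27 := by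
  have h : Real.pi ^ 2 / 3 ≤ 56 / 17 := by
    nlinarith [Real.pi_lt_d4, Real.pi_pos]
  refine (Real.exp_le_exp.2 h).trans ?_
  rw [← pow_le_pow_iff_left₀ (Real.exp_pos _).le (by norm_num) (by norm_num : 17 ≠ 0),
    ← Real.exp_nat_mul]
  have e : ((17 : ℕ) : ℝ) * (56 / 17) = (56 : ℕ) * 1 := by norm_num
  rw [e, Real.exp_nat_mul]
  refine (pow_le_pow_left₀ (Real.exp_pos _).le Real.exp_one_lt_d9.le 56).trans ?_
  norm_num

theorem weightCount_doubledWeights_mul_le {t : ℕ} (ht : 0 < t) (J m : ℕ) :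
    weightCount (doubledWeights J) m * (t ^ m * (t + 1)) ≤ (t + 1) ^ m * 27 ^ t := by
  have ht' : (0 : ℝ) < t := by exact_mod_cast ht
  have h := weightCount_doubledWeights_le ht' J m
  have h2 : Real.exp (Real.pi ^ 2 / 3 * t) ≤ 27 ^ t := by
    rw [mul_comm, Real.exp_nat_mul]
    exact pow_le_pow_left₀ (Real.exp_pos _).le exp_pi_sq_div_three_le t
  have e : (1 + 1 / (t : ℝ)) = (t + 1) / t := by field_simp
  rw [le_div_iff₀ (by positivity), e, div_pow, div_mul_eq_mul_div, le_div_iff₀ (by positivity)] at h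
  have h3 : (weightCount (doubledWeights J) m : ℝ) * (t ^ m * (t + 1)) ≤ (t + 1) ^ m * 27 ^ t :=
    calc _ = (weightCount (doubledWeights J) m : ℝ) * (t + 1) * t ^ m := by ring
      _ ≤ _ := h
      _ ≤ _ := by gcongr
  exact_mod_cast h3

/-! ### Exact weight counts by packing them into one integer -/

/-- The number `∑_{i ≤ I} weightCount L i * B ^ i`. -/
def weightSum (B I : ℕ) (L : List ℕ) : ℕ :=
  ∑ i ∈ Finset.range (I + 1), weightCount L i * B ^ i

theorem weightSum_cons_modEq {w : ℕ} (hw : 0 < w) (B I : ℕ) (L : List ℕ) :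
    weightSum B I (w :: L) ≡ weightSum B I L + B ^ w * weightSum B I (w :: L) [MOD B ^ (I + 1)] := by
  have h1 : weightSum B I (w :: L) = weightSum B I L + ∑ i ∈ Finset.range (I + 1),
      (if w ≤ i then weightCount (w :: L) (i - w) else 0) * B ^ i := by
    rw [weightSum, weightSum, ← Finset.sum_add_distrib]
    refine Finset.sum_congr rfl fun i _ => ?_
    rw [weightCount_cons hw, add_mul]
  have h2 : B ^ w * weightSum B I (w :: L) = ∑ i ∈ Finset.range (w + (I + 1)),
      (if w ≤ i then weightCount (w :: L) (i - w) else 0) * B ^ i := by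
    rw [Finset.sum_range_add, Finset.sum_eq_zero (s := Finset.range w), zero_add, weightSum,
      Finset.mul_sum]
    · refine Finset.sum_congr rfl fun i _ => ?_
      rw [if_pos (by omega), Nat.add_sub_cancel_left, pow_add]
      ring
    · intro i hi
      rw [if_neg (by have := Finset.mem_range.1 hi; omega), zero_mul]
  rw [h2, add_comm w, Finset.sum_range_add, ← add_assoc, ← h1, Nat.ModEq, eq_comm]
  rw [Nat.add_mod, Nat.mod_eq_zero_of_dvd (n := ∑ j ∈ Finset.range w, _), add_zero, Nat.mod_mod]
  refine Finset.dvd_sum fun j _ => ?_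
  rw [pow_add B (I + 1) j]
  exact Dvd.dvd.mul_left (dvd_mul_right _ _) _

/-- `(B ^ (w * t) - 1) / (B ^ w - 1)` is `1 + B ^ w + … + B ^ (w * (t - 1))`, an inverse of
`1 - B ^ w` modulo `B ^ (I + 1)` as soon as `I < w * t`. -/
theorem weightSum_cons_modEq_mul {B w : ℕ} (hB : 2 ≤ B) (hw : 0 < w) (I : ℕ) (L : List ℕ) :
    weightSum B I (w :: L) ≡
      ((B ^ w) ^ (I / w + 1) - 1) / (B ^ w - 1) * weightSum B I L [MOD B ^ (I + 1)] := by
  have hBw : 2 ≤ B ^ w := hB.trans (Nat.le_self_pow hw.ne' B)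
  rw [← Nat.geomSum_eq hBw]
  have h := weightSum_cons_modEq hw B I L
  rw [← Int.natCast_modEq_iff] at h ⊢
  push_cast at h ⊢
  set S' : ℤ := ((weightSum B I (w :: L) : ℕ) : ℤ)
  set S : ℤ := ((weightSum B I L : ℕ) : ℤ)
  set G : ℤ := ∑ k ∈ Finset.range (I / w + 1), ((B : ℤ) ^ w) ^ k with hG
  have hg : G * (1 - (B : ℤ) ^ w) = 1 - ((B : ℤ) ^ w) ^ (I / w + 1) := geom_sum_mul_neg _ _
  have hd : (B : ℤ) ^ (I + 1) ∣ ((B : ℤ) ^ w) ^ (I / w + 1) := by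
    rw [← pow_mul]
    exact pow_dvd_pow _ (Nat.lt_mul_div_succ I hw)
  have h' := h.dvd
  rw [Int.modEq_iff_dvd]
  have e : G * S - S' = G * (S + (B : ℤ) ^ w * S' - S') - ((B : ℤ) ^ w) ^ (I / w + 1) * S' := by
    linear_combination S' * hg
  rw [e]
  exact dvd_sub (Dvd.dvd.mul_left h' _) (Dvd.dvd.mul_right hd _)

/-- A number congruent to `weightSum B I (doubledWeights j)` modulo `B ^ (I + 1)`, in a form that
can be evaluated. -/
def packedWeightSum (B I : ℕ) : ℕ → ℕ
  | 0 => ((B ^ (I + 1) - 1) / (B - 1)) ^ 2 % B ^ (I + 1)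
  | j + 1 => (((B ^ (j + 2)) ^ (I / (j + 2) + 1) - 1) / (B ^ (j + 2) - 1)) ^ 2 *
      packedWeightSum B I j % B ^ (I + 1)

theorem weightSum_doubledWeights_modEq {B : ℕ} (hB : 2 ≤ B) (I J : ℕ) :
    weightSum B I (doubledWeights J) ≡ packedWeightSum B I J [MOD B ^ (I + 1)] := by
  induction J with
  | zero =>
    have h := weightSum_cons_modEq_mul hB one_pos I []
    have h0 : weightSum B I [] = (B ^ (I + 1) - 1) / (B - 1) := by
      rw [← Nat.geomSum_eq hB, weightSum]
      exact Finset.sum_congr rfl fun i _ => by rw [weightCount_nil, one_mul]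
    rw [h0, pow_one, Nat.div_one, ← sq] at h
    exact h.trans (Nat.mod_modEq _ _).symm
  | succ J ih =>
    have h1 := weightSum_cons_modEq_mul hB (by omega : 0 < J + 2) I (doubledWeights J)
    have h2 := weightSum_cons_modEq_mul hB (by omega : 0 < J + 2) I
      ((J + 2) :: doubledWeights J)
    refine (h2.trans (h1.mul_left _)).trans ?_
    rw [← mul_assoc, ← sq]
    exact (ih.mul_left _).trans (Nat.mod_modEq _ _).symm

theorem weightSum_lt {B I : ℕ} {L : List ℕ} (h : ∀ i ≤ I, weightCount L i < B) :
    weightSum B I L < B ^ (I + 1) := by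
  induction I with
  | zero => simpa [weightSum] using h 0 le_rfl
  | succ I ih =>
    have h1 := ih fun i hi => h i (by omega)
    have h2 := h (I + 1) le_rfl
    rw [weightSum, Finset.sum_range_succ]
    rw [weightSum] at h1
    calc _ < B ^ (I + 1) + weightCount L (I + 1) * B ^ (I + 1) := by omega
      _ = (weightCount L (I + 1) + 1) * B ^ (I + 1) := by ring
      _ ≤ B * B ^ (I + 1) := Nat.mul_le_mul_right _ h2
      _ = _ := by ring

/-- All counts are below `B`, so there are no carries and the counts are the base `B` digits. -/
theorem weightCount_eq_of_modEq {B I A m : ℕ} {L : List ℕ} (hB : 0 < B)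
    (h : ∀ i ≤ I, weightCount L i < B) (hA : weightSum B I L ≡ A [MOD B ^ (I + 1)]) (hm : m ≤ I) :
    A % B ^ (m + 1) / B ^ m = weightCount L m := by
  have h1 : weightSum B I L ≡ weightSum B m L [MOD B ^ (m + 1)] := by
    obtain ⟨e, rfl⟩ := Nat.exists_eq_add_of_le hm
    rw [weightSum, show m + e + 1 = m + 1 + e by ring, Finset.sum_range_add, Nat.ModEq, Nat.add_mod,
      Nat.mod_eq_zero_of_dvd (n := ∑ j ∈ Finset.range e, _), add_zero, Nat.mod_mod]
    · rfl
    · refine Finset.dvd_sum fun j _ => ?_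
      rw [pow_add B (m + 1) j]
      exact Dvd.dvd.mul_left (dvd_mul_right _ _) _
  have h2 : A ≡ weightSum B m L [MOD B ^ (m + 1)] :=
    (hA.symm.of_dvd (pow_dvd_pow _ (by omega))).trans h1
  rw [Nat.ModEq, Nat.mod_eq_of_lt (weightSum_lt fun i hi => h i (hi.trans hm))] at h2
  rw [h2]
  have hlow : ∑ i ∈ Finset.range m, weightCount L i * B ^ i < B ^ m := by
    rcases m with _ | m
    · simp
    · exact weightSum_lt fun i hi => h i (by omega)
  rw [weightSum, Finset.sum_range_succ, Nat.add_mul_div_right _ _ (by positivity),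
    Nat.div_eq_of_lt hlow, zero_add]

theorem weightCount_doubledWeights_lt {J m : ℕ} (hm : m ≤ 290) :
    weightCount (doubledWeights J) m < 2 ^ 100 := by
  have h := weightCount_doubledWeights_mul_le (by norm_num : 0 < 5) J m
  norm_num at h
  -- The bound grows with `m`, so scaling by `6 ^ e` against `5 ^ e` leaves only `m = 290` to check.
  obtain ⟨e, he⟩ := Nat.exists_eq_add_of_le hm
  by_contra! hc
  have h1 : 2 ^ 100 * (5 ^ m * 6) ≤ 6 ^ m * 14348907 := (Nat.mul_le_mul_right _ hc).trans h
  have h2 : 2 ^ 100 * (5 ^ m * 6) * 5 ^ e ≤ 6 ^ m * 14348907 * 6 ^ e :=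
    Nat.mul_le_mul h1 (Nat.pow_le_pow_left (by norm_num) e)
  have e1 : 2 ^ 100 * (5 ^ m * 6) * 5 ^ e = 2 ^ 100 * 6 * 5 ^ 290 := by rw [he, pow_add]; ring
  have e2 : 6 ^ m * 14348907 * 6 ^ e = 14348907 * 6 ^ 290 := by rw [he, pow_add]; ring
  rw [e1, e2] at h2
  revert h2
  decide +kernel

/-! ### The inequality in `m = k ^ 2 + i`, by the size of `k` -/

/-- A lower bound for the number `N` such that `n = N + k + d * (k * (k - 1) / 2)`, valid if `15 ≤ d`
and `(2 * d - 1) * m ≤ 2 * n`. -/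
def gapSlack (m k : ℕ) : ℕ := (29 * m - (15 * (k * (k - 1)) + 2 * k) + 1) / 2

theorem weightCount_le_ascFactorial_of_lt {k i : ℕ} (hk : k < 17) (hi : i < 2 * k + 1)
    (hm : 2 ≤ k ^ 2 + i) : ∃ e < 2, 15 * ((k + e) * (k + e - 1)) + 2 * (k + e) ≤ 29 * (k ^ 2 + i) ∧
      (k + e).factorial * (k + e - 1).factorial *
        weightCount (doubledWeights 289) (k ^ 2 + i) ≤
          (gapSlack (k ^ 2 + i) (k + e) + 1).ascFactorial (k + e - 1) := by
  -- Here `k ^ 2 + i ≤ 288`, within the packed range. The packed integer is abstracted so that it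
  -- occurs only once.
  have key : ∀ k < 17, ∀ i < 2 * k + 1, 2 ≤ k ^ 2 + i →
      (fun A => ∃ e < 2, 15 * ((k + e) * (k + e - 1)) + 2 * (k + e) ≤ 29 * (k ^ 2 + i) ∧
        (k + e).factorial * (k + e - 1).factorial *
          (A % (2 ^ 100) ^ (k ^ 2 + i + 1) / (2 ^ 100) ^ (k ^ 2 + i)) ≤
            (gapSlack (k ^ 2 + i) (k + e) + 1).ascFactorial (k + e - 1))
      (packedWeightSum (2 ^ 100) 290 289) := by
    decide +kernel
  have h := key k hk i hi hm
  beta_reduce at h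
  rwa [weightCount_eq_of_modEq (by positivity) (fun i hi => weightCount_doubledWeights_lt hi)
    (weightSum_doubledWeights_modEq (by norm_num) 290 289) (by nlinarith)] at h

theorem weightCount_le_ascFactorial_of_lt_of_le {k i : ℕ} (hk : k < 45) (hk' : 17 ≤ k)
    (hi : i < 2 * k + 1) (J : ℕ) :
    k.factorial * (k - 1).factorial * weightCount (doubledWeights J) (k ^ 2 + i) ≤
      (gapSlack (k ^ 2 + i) k + 1).ascFactorial (k - 1) := by
  have key : ∀ k < 45, 17 ≤ k → ∀ i < 2 * k + 1,
      (fun t => k.factorial * (k - 1).factorial * ((t + 1) ^ (k ^ 2 + i) * 27 ^ t) ≤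
        (gapSlack (k ^ 2 + i) k + 1).ascFactorial (k - 1) * (t ^ (k ^ 2 + i) * (t + 1)))
      -- The exponent `m / t + π² t / 3` is least at `t = √(3m) / π`, about `k / 1.814`.
      (1000 * k / 1814) := by
    decide +kernel
  have h := key k hk hk' i hi
  beta_reduce at h
  have ht : 0 < 1000 * k / 1814 := by omega
  refine Nat.le_of_mul_le_mul_right (c := (1000 * k / 1814) ^ (k ^ 2 + i) * (1000 * k / 1814 + 1))
    ?_ (by positivity)
  refine le_trans ?_ h
  rw [mul_assoc]
  exact Nat.mul_le_mul_left _ (weightCount_doubledWeights_mul_le ht J _)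

theorem exp_le_of_le_three_point_six {x : ℝ} (hx : x ≤ 98 / 27) : Real.exp x ≤ 943 / 25 := by
  refine (Real.exp_le_exp.2 hx).trans ?_
  rw [← pow_le_pow_iff_left₀ (Real.exp_pos _).le (by norm_num) (by norm_num : 27 ≠ 0),
    ← Real.exp_nat_mul]
  have e : ((27 : ℕ) : ℝ) * (98 / 27) = (98 : ℕ) * 1 := by norm_num
  rw [e, Real.exp_nat_mul]
  refine (pow_le_pow_left₀ (Real.exp_pos _).le Real.exp_one_lt_d9.le 98).trans ?_
  norm_num

theorem exp_neg_nineteen_div_ten_le : Real.exp (-(19 / 10)) ≤ 175 / 943 := by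
  rw [Real.exp_neg, inv_le_comm₀ (Real.exp_pos _) (by norm_num),
    ← pow_le_pow_iff_left₀ (by norm_num) (Real.exp_pos _).le (by norm_num : 10 ≠ 0),
    ← Real.exp_nat_mul]
  have e : ((10 : ℕ) : ℝ) * (19 / 10) = (19 : ℕ) * 1 := by norm_num
  rw [e, Real.exp_nat_mul]
  refine le_trans ?_ (pow_le_pow_left₀ (by norm_num) Real.exp_one_gt_d9.le 19)
  norm_num

/-- Here `943 / 25` bounds the growth of the weight count per unit of `k`, and `7 = (29 - 15) / 2`
is the leading coefficient of the slack. The induction step needs `175 / 943 = 7 / (943 / 25)`. -/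
theorem factorial_mul_factorial_le {j : ℕ} (hj : 44 ≤ j) :
    ((j + 1).factorial : ℝ) * j.factorial * (943 / 25) ^ (j + 1) ≤ (7 * ((j : ℝ) + 1) ^ 2) ^ j := by
  induction j, hj using Nat.le_induction with
  | base => norm_num [Nat.factorial]
  | succ j hj ih =>
    have hj' : (44 : ℝ) ≤ j := by exact_mod_cast hj
    have h1 : ((j : ℝ) + 1) / (j + 2) ≤ Real.exp (-(1 / (j + 2))) := by
      have := Real.add_one_le_exp (-(1 / ((j : ℝ) + 2)))
      refine le_trans (le_of_eq ?_) this
      field_simp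
      ring
    have h2 : (((j : ℝ) + 1) / (j + 2)) ^ (2 * j + 1) ≤ 175 / 943 := by
      refine (pow_le_pow_left₀ (by positivity) h1 _).trans ?_
      rw [← Real.exp_nat_mul]
      refine (Real.exp_le_exp.2 ?_).trans exp_neg_nineteen_div_ten_le
      rw [mul_neg, neg_le_neg_iff, mul_one_div, le_div_iff₀ (by positivity)]
      push_cast
      linarith
    rw [div_pow, div_le_iff₀ (by positivity)] at h2
    have e1 : ((j + 1 + 1).factorial : ℝ) * (j + 1).factorial * (943 / 25) ^ (j + 1 + 1) =
        ((j : ℝ) + 2) * (j + 1) * (943 / 25) *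
          (((j + 1).factorial : ℝ) * j.factorial * (943 / 25) ^ (j + 1)) := by
      rw [Nat.factorial_succ (j + 1), Nat.factorial_succ j]
      push_cast
      ring
    rw [e1]
    calc _ ≤ ((j : ℝ) + 2) * (j + 1) * (943 / 25) * (7 * ((j : ℝ) + 1) ^ 2) ^ j := by gcongr
      _ = ((j : ℝ) + 2) * (943 / 25) * 7 ^ j * ((j : ℝ) + 1) ^ (2 * j + 1) := by
        rw [mul_pow, ← pow_mul]; ring
      _ ≤ ((j : ℝ) + 2) * (943 / 25) * 7 ^ j * (175 / 943 * ((j : ℝ) + 2) ^ (2 * j + 1)) := by gcongr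
      _ = (7 * (((j + 1 : ℕ) : ℝ) + 1) ^ 2) ^ (j + 1) := by
        push_cast
        rw [mul_pow, ← pow_mul]
        ring

/-- Absorbs the excess `i = m - k ^ 2`: its cost `i / θ`, with `θ = 11k / 20`, is covered by the
growth of the slack, using `log (Z / Y) ≥ (Z - Y) / Z`. -/
theorem mul_exp_le_pow {j i : ℝ} (n : ℕ) (hn : (n : ℝ) = j) (hj : 44 ≤ j) (hi : 0 ≤ i)
    (hi' : i ≤ 2 * (j + 1)) :
    (7 * (j + 1) ^ 2) ^ n * Real.exp (i / (11 / 20 * (j + 1))) ≤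
      (7 * (j + 1) ^ 2 + 13 / 2 * (j + 1) + 29 / 2 * i) ^ n := by
  set Y := 7 * (j + 1) ^ 2 with hY
  set Z := Y + 13 / 2 * (j + 1) + 29 / 2 * i with hZ
  have hY0 : 0 < Y := by positivity
  have hZ0 : 0 < Z := by positivity
  have h1 : Y / Z ≤ Real.exp (-((Z - Y) / Z)) := by
    have := Real.add_one_le_exp (-((Z - Y) / Z))
    refine le_trans (le_of_eq ?_) this
    field_simp
    ring
  have h2 := pow_le_pow_left₀ (by positivity) h1 n
  rw [← Real.exp_nat_mul, div_pow, div_le_iff₀ (by positivity)] at h2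
  have h3 : i / (11 / 20 * (j + 1)) ≤ n * ((Z - Y) / Z) := by
    rw [hn, ← mul_div_assoc, div_le_div_iff₀ (by positivity) hZ0]
    have a1 : i * Z ≤ i * (7 * (j + 1) ^ 2 + 71 / 2 * (j + 1)) :=
      mul_le_mul_of_nonneg_left (by rw [hZ]; linarith) hi
    -- After cancelling, `7k + 71/2 ≤ (319/40)(k - 1)`, which first holds at `k = 45`; `319/40` is
    -- `29/2 · 11/20`.
    have a2 : i * (7 * (j + 1) ^ 2 + 71 / 2 * (j + 1)) ≤ i * (319 / 40 * j * (j + 1)) :=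
      mul_le_mul_of_nonneg_left (by nlinarith) hi
    have a3 : i * (319 / 40 * j * (j + 1)) ≤ j * (Z - Y) * (11 / 20 * (j + 1)) := by
      have : 0 ≤ j * (13 / 2 * (j + 1)) * (11 / 20 * (j + 1)) := by positivity
      rw [hZ]
      linarith
    linarith
  calc Y ^ n * Real.exp (i / (11 / 20 * (j + 1)))
      ≤ (Real.exp (n * -((Z - Y) / Z)) * Z ^ n) * Real.exp (n * ((Z - Y) / Z)) := by gcongr
    _ = Z ^ n := by
      rw [mul_neg, Real.exp_neg]
      field_simp

theorem weightCount_le_ascFactorial_of_le {k i : ℕ} (hk : 45 ≤ k) (hi : i < 2 * k + 1) (J : ℕ) :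
    k.factorial * (k - 1).factorial * weightCount (doubledWeights J) (k ^ 2 + i) ≤
      (gapSlack (k ^ 2 + i) k + 1).ascFactorial (k - 1) := by
  obtain ⟨j, rfl⟩ : ∃ j, k = j + 1 := ⟨k - 1, by omega⟩
  rw [Nat.add_sub_cancel]
  have hj : 44 ≤ j := by omega
  have hj' : (44 : ℝ) ≤ j := by exact_mod_cast hj
  have hi' : (i : ℝ) ≤ 2 * ((j : ℝ) + 1) := by exact_mod_cast (by omega : i ≤ 2 * (j + 1))
  have hθ : (0 : ℝ) < 11 / 20 * ((j : ℝ) + 1) := by positivity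
  -- `11 / 20` approximates the optimal ratio `√3 / π`.
  have h1 := weightCount_doubledWeights_le hθ J ((j + 1) ^ 2 + i)
  have h2 : (weightCount (doubledWeights J) ((j + 1) ^ 2 + i) : ℝ) ≤
      (943 / 25) ^ (j + 1) * Real.exp (i / (11 / 20 * ((j : ℝ) + 1))) := by
    refine h1.trans ((div_le_self (by positivity) (by linarith)).trans ?_)
    have h3 : (1 + 1 / (11 / 20 * ((j : ℝ) + 1))) ^ ((j + 1) ^ 2 + i) ≤
        Real.exp (((j + 1) ^ 2 + i : ℕ) * (1 / (11 / 20 * ((j : ℝ) + 1)))) := by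
      rw [Real.exp_nat_mul]
      refine pow_le_pow_left₀ (by positivity) ?_ _
      rw [add_comm]
      exact Real.add_one_le_exp _
    have e : ((j + 1) ^ 2 + i : ℕ) * (1 / (11 / 20 * ((j : ℝ) + 1))) +
        Real.pi ^ 2 / 3 * (11 / 20 * ((j : ℝ) + 1)) =
        (j + 1 : ℕ) * (20 / 11 + Real.pi ^ 2 / 3 * (11 / 20)) + i / (11 / 20 * ((j : ℝ) + 1)) := by
      push_cast
      field_simp
      ring
    calc _ ≤ Real.exp (((j + 1) ^ 2 + i : ℕ) * (1 / (11 / 20 * ((j : ℝ) + 1)))) *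
          Real.exp (Real.pi ^ 2 / 3 * (11 / 20 * ((j : ℝ) + 1))) := by gcongr
      _ = Real.exp (20 / 11 + Real.pi ^ 2 / 3 * (11 / 20)) ^ (j + 1) *
          Real.exp (i / (11 / 20 * ((j : ℝ) + 1))) := by
        rw [← Real.exp_add, e, Real.exp_add, Real.exp_nat_mul]
      _ ≤ _ := by
        gcongr
        refine exp_le_of_le_three_point_six ?_
        nlinarith [Real.pi_lt_d4, Real.pi_pos]
  have h4 : 7 * ((j : ℝ) + 1) ^ 2 + 13 / 2 * ((j : ℝ) + 1) + 29 / 2 * i ≤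
      (gapSlack ((j + 1) ^ 2 + i) (j + 1) + 1 : ℕ) := by
    have : 29 * ((j + 1) ^ 2 + i) ≤
        2 * (gapSlack ((j + 1) ^ 2 + i) (j + 1) + 1) + (15 * ((j + 1) * j) + 2 * (j + 1)) := by
      rw [gapSlack, Nat.add_sub_cancel]
      omega
    have : 29 * (((j : ℝ) + 1) ^ 2 + i) ≤
        2 * ((gapSlack ((j + 1) ^ 2 + i) (j + 1) + 1 : ℕ) : ℝ) +
          (15 * (((j : ℝ) + 1) * j) + 2 * ((j : ℝ) + 1)) := by exact_mod_cast this
    linarith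
  have h5 : (((j + 1).factorial * j.factorial *
      weightCount (doubledWeights J) ((j + 1) ^ 2 + i) : ℕ) : ℝ) ≤
      ((gapSlack ((j + 1) ^ 2 + i) (j + 1) + 1 : ℕ) : ℝ) ^ j := by
    push_cast only [Nat.cast_mul]
    calc _ ≤ ((j + 1).factorial : ℝ) * j.factorial *
          ((943 / 25) ^ (j + 1) * Real.exp (i / (11 / 20 * ((j : ℝ) + 1)))) := by gcongr
      _ = ((j + 1).factorial : ℝ) * j.factorial * (943 / 25) ^ (j + 1) *
          Real.exp (i / (11 / 20 * ((j : ℝ) + 1))) := by ring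
      _ ≤ (7 * ((j : ℝ) + 1) ^ 2) ^ j * Real.exp (i / (11 / 20 * ((j : ℝ) + 1))) := by
        gcongr
        exact factorial_mul_factorial_le hj
      _ ≤ _ := mul_exp_le_pow j rfl hj' (by positivity) hi'
      _ ≤ _ := pow_le_pow_left₀ (by positivity) h4 j
  exact (by exact_mod_cast h5 : _ ≤ (gapSlack ((j + 1) ^ 2 + i) (j + 1) + 1) ^ j).trans
    (Nat.pow_succ_le_ascFactorial _ _)

/-! ### Reduction to `d = 15` and conclusion -/

theorem ascFactorial_gapSlack_le {d n m k : ℕ} (hd : 15 ≤ d) (hm : m = 2 * n / (2 * d - 1))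
    (hk : 1 ≤ k) (h : 15 * (k * (k - 1)) + 2 * k ≤ 29 * m) :
    (gapSlack m k + 1).ascFactorial (k - 1) ≤
      k.factorial * (k - 1).factorial * gapPartitionCount d 1 n := by
  obtain ⟨j, rfl⟩ : ∃ j, k = j + 1 := ⟨k - 1, by omega⟩
  obtain ⟨c, rfl⟩ := Nat.exists_eq_add_of_le hd
  have hmn : (2 * (15 + c) - 1) * m ≤ 2 * n := by
    rw [hm]
    exact Nat.mul_div_le _ _
  rw [show 2 * (15 + c) - 1 = 29 + 2 * c by omega] at hmn
  obtain ⟨t, ht⟩ : ∃ t, j * (j + 1) = 2 * t := (Nat.even_mul_succ_self j).two_dvd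
  have ht' : (j + 1) * j = 2 * t := by rw [mul_comm, ht]
  rw [Nat.add_sub_cancel] at h ⊢
  rw [gapSlack, Nat.add_sub_cancel]
  rw [ht'] at h ⊢
  -- Raising `d` by `c` adds `c * m` to the lower bound for `n` and only `c * t` to the staircase,
  -- so the slack at `d = 15` remains valid.
  have htm : t ≤ m := by omega
  have hct : c * t ≤ c * m := Nat.mul_le_mul_left c htm
  have hmn' : 29 * m + 2 * (c * m) ≤ 2 * n := by linarith
  have hle : (29 * m - (15 * (2 * t) + 2 * (j + 1)) + 1) / 2 ≤
      n - ((j + 1) + (15 * t + c * t)) := by omega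
  have hn : n - ((j + 1) + (15 * t + c * t)) + (j + 1) + (15 + c) * (j * (j + 1) / 2) = n := by
    rw [ht, Nat.mul_div_cancel_left _ (by norm_num), add_mul]
    omega
  have h1 := ascFactorial_le_mul_ncard_gapLists (15 + c) j (n - ((j + 1) + (15 * t + c * t)))
  rw [hn] at h1
  exact (ascFactorial_mono (Nat.succ_le_succ hle) j).trans
    (h1.trans (Nat.mul_le_mul_left _ (ncard_gapLists_le _ _ _)))

theorem exists_weightCount_le_ascFactorial {m : ℕ} (hm : 2 ≤ m) :
    ∃ J k, m ≤ J + 1 ∧ 1 ≤ k ∧ 15 * (k * (k - 1)) + 2 * k ≤ 29 * m ∧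
      k.factorial * (k - 1).factorial * weightCount (doubledWeights J) m ≤
        (gapSlack m k + 1).ascFactorial (k - 1) := by
  obtain ⟨k, i, hi, rfl⟩ : ∃ k i, i < 2 * k + 1 ∧ m = k ^ 2 + i := by
    refine ⟨m.sqrt, m - m.sqrt ^ 2, ?_, ?_⟩
    · have := Nat.sqrt_le_add m
      have := Nat.sqrt_le' m
      rw [sq]
      omega
    · have := Nat.sqrt_le' m
      omega
  rcases Nat.lt_or_ge k 17 with hk | hk
  · obtain ⟨e, -, h1, h2⟩ := weightCount_le_ascFactorial_of_lt hk hi hm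
    refine ⟨289, k + e, by nlinarith, ?_, h1, h2⟩
    rcases k with _ | k
    · omega
    · omega
  · have h1 : 15 * (k * (k - 1)) + 2 * k ≤ 29 * (k ^ 2 + i) := by
      obtain ⟨j, rfl⟩ : ∃ j, k = j + 1 := ⟨k - 1, by omega⟩
      rw [Nat.add_sub_cancel]
      nlinarith
    refine ⟨k ^ 2 + i, k, by omega, by omega, h1, ?_⟩
    rcases Nat.lt_or_ge k 45 with hk' | hk'
    · exact weightCount_le_ascFactorial_of_lt_of_le hk' hk hi _
    · exact weightCount_le_ascFactorial_of_le hk' hi _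

theorem residuePartitionCount_le_gapPartitionCount {d n : ℕ} (hd : 15 ≤ d) (hn : 1 ≤ n) :
    residuePartitionCount (d - 3) 1 n ≤ gapPartitionCount d 1 n := by
  rcases Nat.lt_or_ge (2 * n / (2 * d - 1)) 2 with hm | hm
  -- For `m ≤ 1` the weight count is at most `2`, so `Q ≤ 1` by strictness, while `n` alone is a
  -- partition counted by `q`.
  · have h1 := residuePartitionCount_lt (J := 0) (by omega : 4 ≤ d) hn (by omega)
    have h2 : weightCount (doubledWeights 0) (2 * n / (2 * d - 1)) ≤ 2 := by
      have h0 : weightCount [1] 0 = 1 := by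
        rw [weightCount_cons one_pos, weightCount_nil]; simp
      rcases Nat.lt_or_ge (2 * n / (2 * d - 1)) 1 with h | h
      · rw [Nat.lt_one_iff.1 h, doubledWeights, h0]; norm_num
      · rw [show 2 * n / (2 * d - 1) = 1 by omega, doubledWeights, weightCount_cons one_pos,
          weightCount_nil]
        simp [h0]
    have h3 : 1 ≤ gapPartitionCount d 1 n := by
      have : [n] ∈ gapLists d 1 n := ⟨by simp, by simpa using hn, by simp, by simp⟩
      exact ((Set.ncard_pos (finite_gapLists _ _ _)).2 ⟨_, this⟩).trans_le (ncard_gapLists_le _ _ _)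
    omega
  · obtain ⟨J, k, hJ, hk, h1, h2⟩ := exists_weightCount_le_ascFactorial hm
    have h3 := h2.trans (ascFactorial_gapSlack_le hd rfl hk h1)
    exact (residuePartitionCount_lt (by omega) hn hJ).le.trans
      (Nat.le_of_mul_le_mul_left h3 (by positivity))

theorem mainTheorem3 (d : ℕ) (hd : d = 15 ∨ 31 ≤ d) (n : ℕ) (hn : 1 ≤ n) :
    residuePartitionCount (d - 3) 1 n ≤ gapPartitionCount d 1 n := by
  exact residuePartitionCount_le_gapPartitionCount (by omega) hn
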